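/- **Conventions.** A 2-crossed module $\mathcal A=(L\xrightarrow{\delta}E\xrightarrow{\partial}G,\triangleright,\{,\})$ consists of groups and homomorphisms with $\partial\delta=1$, left actions $\triangleright$ of $G$ on $E$ and $L$ by automorphisms for which $\partial$ and $\delta$ are equivariant ($G$ acting on itself by conjugation), and a $G$-equivariant map $\{,\}\colon E\times E\to L$ such that, with $e\triangleright' l=l\{\delta(l)^{-1},e\}$ and for all $e,f,g\in E$, $l,k\in L$: $\delta\{e,f\}=efe^{-1}\,(\partial(e)\triangleright f^{-1})$; $[l,k]=\{\delta(l),\delta(k)\}$; $\{\delta(l),e\}\{e,\delta(l)\}=l\,(\partial(e)\triangleright l^{-1})$; $\{ef,g\}=\{e,fgf^{-1}\}\,\partial(e)\triangleright\{f,g\}$; $\{e,fg\}=\{e,f\}\,(\partial(e)\triangleright f)\triangleright'\{e,g\}$. A map of 2-crossed modules is a triple of homomorphisms $(\mu,\psi,\phi)$ (on $L$, $E$, $G$ respectively) preserving $\delta,\partial$, the actions and $\{,\}$. Semidirect products carry the product $(g,n)(g',n')=(gg',(g'^{-1}\triangleright n)\,n')$. For a group map $\phi\colon F\to G$, a $\phi$-derivation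 is a map $s\colon F\to E$ with $s(gh)=(\phi(h)^{-1}\triangleright s(g))\,s(h)$. Let $\mathcal A'=(L'\xrightarrow{\delta}E'\xrightarrow{\partial}F)$ and $\mathcal A=(L\xrightarrow{\delta}E\xrightarrow{\partial}G)$ be 2-crossed modules. A homotopy $f\xrightarrow{(f,s,t)}f'$ between maps $f=(\mu,\psi,\phi)$ and $f'=(\mu',\psi',\phi')$ from $\mathcal A'$ to $\mathcal A$ consists of a $\phi$-derivation $s\colon F\to E$ and a map $t\colon E'\to L$ such that, for all $a,b\in E'$ and $g\in F$, $$t(ab)=\big(\psi(b)s(\partial b)\big)^{-1}\triangleright'\Big(\{\psi(b),\phi(\partial b)^{-1}\triangleright s(\partial a)^{-1}\}\,t(a)\Big)\,t(b),$$ $$t(g\triangleright a)=\phi(g)\triangleright\Big(\big(s(g)s(\partial a)^{-1}\big)\triangleright'\{\psi(a)^{-1},s(g)^{-1}\}^{-1}\Big)\;\phi(g)\triangleright\{s(g),s(\partial a)^{-1}\psi(a)^{-1}\}\;\big(\phi(g)\,\partial (s(g))\big)\triangleright t(a),$$ and $\mu'(l)=\mu(l)\,t(\delta l)$, $\psi'(a)=\psi(a)\,s(\partial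 a)\,\delta(t(a))$, $\phi'(g)=\phi(g)\,\partial(s(g))$ for all $l\in L'$, $a\in E'$, $g\in F$. The formula $(g,x)\bullet(e,k)=\big(g\triangleright(xex^{-1}),\,g\triangleright(\{x,e^{-1}\}\,\partial(x)\triangleright k)\big)$ defines an action of $G\ltimes_\triangleright E$ on $E\ltimes_{\triangleright'}L$ by automorphisms. If $F$ is free with basis $B$, and $s,s'\colon F\to E$ are maps, let $\omega^{(s,s')}(g)\in L$ be the last component of $X(g)$, where $X\colon F\to (G\ltimes_\triangleright E)\ltimes_\bullet(E\ltimes_{\triangleright'}L)$ is the unique group map with $X(b)=(\phi(b),s(b),s'(b),1)$ for all $b\in B$. **Theorem.** Suppose that $F$ is a free group with a chosen basis $B$. Then there is a groupoid $[\mathcal A',\mathcal A]^B_1$ whose objects are the 2-crossed module maps $\mathcal A'\to\mathcal A$ and whose morphisms $f\to f'$ are the homotopies connecting $f$ and $f'$, with the following operations. 1. The composite (concatenation) of $f\xrightarrow{(f,s,t)}f'\xrightarrow{(f',s',t')}f''$ is $f\xrightarrow{(f,s\otimes s',t\otimes t')}f''$, where $s\otimes s'$ is the unique $\phi$-derivation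 with $(s\otimes s')(b)=s(b)s'(b)$ for all $b\in B$, and $(t\otimes t')(e)=\omega^{(s,s')}(\partial e)\,\big(s'(\partial e)^{-1}\triangleright' t(e)\big)\,t'(e)$ for all $e\in E'$. Moreover $(s\otimes s')(g)=s(g)\,s'(g)\,\delta\big(\omega^{(s,s')}(g)\big)^{-1}$ for all $g\in F$. 2. The unit at $f$ is the homotopy with $s(g)=1$ and $t(e)=1$ for all $g\in F$, $e\in E'$. 3. The inverse of $f\xrightarrow{(f,s,t)}f'$ is $f'\xrightarrow{(f',\bar s,\bar t)}f$, where $\bar s$ is the unique $\phi'$-derivation with $\bar s(b)=s(b)^{-1}$ for all $b\in B$, and $\bar t(e)=\big(\omega^{(s,\bar s)}(\partial e)\big)^{-1}\,\big(s(\partial e)\triangleright' t(e)^{-1}\big)$ for all $e\in E'$. -/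

import Mathlib

universe u₁ u₂ u₃ u₄ u₅ u₆

/-- A 2-crossed module of groups `L --δ--> E --∂--> G`, with left actions by automorphisms of `G`
on `E` and on `L`, and a Peiffer lifting `{ , } : E × E → L`. In `lift_mul_right` the term
`x * {δ x⁻¹, ∂ e ▹ f}`, with `x = {e, g}`, is the secondary action `(∂ e ▹ f) ▹' {e, g}`. -/
structure TwoCrossedModule (L E G : Type*) [Group L] [Group E] [Group G] where
  δ : L →* E
  bd : E →* G
  actE : G →* MulAut E
  actL : G →* MulAut L
  lift : E → E → L
  bd_delta : ∀ l, bd (δ l) = 1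
  bd_act : ∀ g e, bd (actE g e) = g * bd e * g⁻¹
  delta_act : ∀ g l, δ (actL g l) = actE g (δ l)
  act_lift : ∀ g e f, actL g (lift e f) = lift (actE g e) (actE g f)
  delta_lift : ∀ e f, δ (lift e f) = (e * f * e⁻¹) * actE (bd e) f⁻¹
  lift_delta_delta : ∀ l k, l * k * l⁻¹ * k⁻¹ = lift (δ l) (δ k)
  lift_delta_mul : ∀ e l, lift (δ l) e * lift e (δ l) = l * actL (bd e) l⁻¹
  lift_mul_left : ∀ e f g,
    lift (e * f) g = lift e (f * g * f⁻¹) * actL (bd e) (lift f g)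
  lift_mul_right : ∀ e f g,
    lift e (f * g) =
      lift e f * (lift e g * lift (δ (lift e g))⁻¹ (actE (bd e) f))

/-- The semidirect product `G ⋉ N` with the convention
`(g, n) (g', n') = (g g', (g'⁻¹ ▹ n) n')`. -/
@[ext] structure RightSemidirect {G N : Type*} [Group G] [Group N] (θ : G →* MulAut N) where
  left : G
  right : N

namespace RightSemidirect

variable {G N : Type*} [Group G] [Group N] {θ : G →* MulAut N}

instance : Mul (RightSemidirect θ) :=
  ⟨fun x y => ⟨x.left * y.left, θ y.left⁻¹ x.right * y.right⟩⟩

instance : One (RightSemidirect θ) := ⟨⟨1, 1⟩⟩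

instance : Inv (RightSemidirect θ) := ⟨fun x => ⟨x.left⁻¹, θ x.left x.right⁻¹⟩⟩

@[simp] theorem mul_left (x y : RightSemidirect θ) : (x * y).left = x.left * y.left := rfl

@[simp] theorem mul_right (x y : RightSemidirect θ) :
    (x * y).right = θ y.left⁻¹ x.right * y.right := rfl

@[simp] theorem one_left : (1 : RightSemidirect θ).left = 1 := rfl

@[simp] theorem one_right : (1 : RightSemidirect θ).right = 1 := rfl

@[simp] theorem inv_left (x : RightSemidirect θ) : (x⁻¹).left = x.left⁻¹ := rfl

@[simp] theorem inv_right (x : RightSemidirect θ) : (x⁻¹).right = θ x.left x.right⁻¹ := rfl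

instance : Group (RightSemidirect θ) :=
  Group.ofLeftAxioms
    (fun x y z => by ext <;> simp [mul_assoc])
    (fun x => by ext <;> simp)
    (fun x => by ext <;> simp)

end RightSemidirect

namespace TwoCrossedModule

section Actions

variable {L E G : Type*} [Group L] [Group E] [Group G] (A : TwoCrossedModule L E G)

/-- The secondary action `e ▹' l = l {δ l⁻¹, e}` as a function. -/
def secFun (e : E) (l : L) : L := l * A.lift (A.δ l)⁻¹ e

theorem lift_one_left (e : E) : A.lift 1 e = 1 := by
  have h := A.lift_mul_left 1 1 e
  simpa using h

theorem lift_one_right (e : E) : A.lift e 1 = 1 := by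
  have key : ∀ l, A.lift (A.δ l) 1 = 1 := fun l => by
    have h := A.lift_delta_mul 1 l
    simpa [lift_one_left] using h
  have h := A.lift_mul_right e 1 1
  rw [map_one, ← map_inv, key] at h
  simpa using h

theorem secFun_one_left (l : L) : A.secFun 1 l = l := by
  simp [secFun, lift_one_right]

theorem delta_secFun (e : E) (l : L) : A.δ (A.secFun e l) = e * A.δ l * e⁻¹ := by
  simp [secFun, A.delta_lift, A.bd_delta, mul_assoc]

theorem secFun_delta (k l : L) : A.secFun (A.δ k) l = k * l * k⁻¹ := by
  rw [secFun, ← map_inv, ← A.lift_delta_delta]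
  group

theorem lift_mul_right' (e f g : E) :
    A.lift e (f * g) = A.lift e f * A.secFun (A.actE (A.bd e) f) (A.lift e g) :=
  A.lift_mul_right e f g

theorem secFun_mul_right (e : E) (k l : L) :
    A.secFun e (k * l) = A.secFun e k * A.secFun e l := by
  have h1 := A.lift_mul_left (A.δ l)⁻¹ (A.δ k)⁻¹ e
  have hb : A.bd (A.δ l)⁻¹ = 1 := by simp [A.bd_delta]
  have hm : (A.δ k)⁻¹ * e * A.δ k = A.δ (A.lift (A.δ k)⁻¹ e) * e := by
    simp [A.delta_lift, A.bd_delta, mul_assoc]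
  have h2 := A.lift_mul_right' (A.δ l)⁻¹ (A.δ (A.lift (A.δ k)⁻¹ e)) e
  rw [hb] at h1 h2
  simp only [map_one, MulAut.one_apply, inv_inv] at h1 h2
  rw [secFun_delta, ← map_inv A.δ l, ← A.lift_delta_delta] at h2
  rw [hm, ← map_inv A.δ l, h2] at h1
  simp only [secFun, map_mul, mul_inv_rev]
  rw [← map_inv A.δ l, h1]
  group

theorem secFun_mul_left (e f : E) (l : L) :
    A.secFun (e * f) l = A.secFun e (A.secFun f l) := by
  have h := A.lift_mul_right' (A.δ l)⁻¹ e f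
  have hb : A.bd (A.δ l)⁻¹ = 1 := by simp [A.bd_delta]
  rw [hb] at h
  simp only [map_one, MulAut.one_apply] at h
  rw [show A.secFun f l = l * A.lift (A.δ l)⁻¹ f from rfl, secFun_mul_right, secFun, h]
  simp [secFun, mul_assoc]

/-- The secondary action `▹'` of `E` on `L` by automorphisms, `e ▹' l = l {δ l⁻¹, e}`. -/
def sec : E →* MulAut L where
  toFun e :=
    { toFun := A.secFun e
      invFun := A.secFun e⁻¹
      left_inv := fun l => by rw [← secFun_mul_left, inv_mul_cancel, secFun_one_left]
      right_inv := fun l => by rw [← secFun_mul_left, mul_inv_cancel, secFun_one_left]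
      map_mul' := A.secFun_mul_right e }
  map_one' := by ext l; exact A.secFun_one_left l
  map_mul' e f := by ext l; exact A.secFun_mul_left e f l

theorem sec_apply (e : E) (l : L) : A.sec e l = l * A.lift (A.δ l)⁻¹ e := rfl

theorem sec_delta (k l : L) : A.sec (A.δ k) l = k * l * k⁻¹ := A.secFun_delta k l

theorem act_sec (g : G) (e : E) (l : L) :
    A.actL g (A.sec e l) = A.sec (A.actE g e) (A.actL g l) := by
  simp [sec_apply, A.act_lift, A.delta_act]

theorem lift_mul_right_sec (x f g : E) :
    A.lift x (f * g) = A.sec (x * f * x⁻¹) (A.lift x g) * A.lift x f := by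
  have h : x * f * x⁻¹ = A.δ (A.lift x f) * A.actE (A.bd x) f := by
    simp [A.delta_lift, mul_assoc]
  rw [h, map_mul, MulAut.mul_apply, sec_delta]
  rw [inv_mul_cancel_right]
  exact A.lift_mul_right' x f g

/-- The group `E ⋉ L`, formed with the secondary action. -/
abbrev EL := RightSemidirect A.sec

/-- The group `G ⋉ E`, formed with the action of `G` on `E`. -/
abbrev GE := RightSemidirect A.actE

/-- `(g, x) • (e, k) = (g ▹ (x e x⁻¹), g ▹ ({x, e⁻¹} (∂ x ▹ k)))`. -/
def liftedFun (u : A.GE) (n : A.EL) : A.EL :=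
  ⟨A.actE u.left (u.right * n.left * u.right⁻¹),
    A.actL u.left (A.lift u.right n.left⁻¹ * A.actL (A.bd u.right) n.right)⟩

theorem liftedFun_mul_right (u : A.GE) (m n : A.EL) :
    A.liftedFun u (m * n) = A.liftedFun u m * A.liftedFun u n := by
  obtain ⟨g, x⟩ := u
  obtain ⟨e, k⟩ := m
  obtain ⟨e', k'⟩ := n
  ext
  · simp [liftedFun, mul_assoc]
  · simp only [liftedFun, RightSemidirect.mul_right, RightSemidirect.mul_left]
    rw [← map_inv (A.actE g), ← act_sec, ← map_mul]
    congr 1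
    rw [mul_inv_rev, lift_mul_right_sec, map_mul (A.actL (A.bd x)), act_sec, mul_inv_rev, mul_inv_rev, inv_inv,
      ← mul_assoc x, map_mul (A.sec (x * e'⁻¹ * x⁻¹))]
    have h : x * e'⁻¹ * x⁻¹ = A.δ (A.lift x e'⁻¹) * A.actE (A.bd x) e'⁻¹ := by
      simp [A.delta_lift, mul_assoc]
    have h2 : A.sec (x * e'⁻¹ * x⁻¹) (A.actL (A.bd x) k) * A.lift x e'⁻¹
        = A.lift x e'⁻¹ * A.sec (A.actE (A.bd x) e'⁻¹) (A.actL (A.bd x) k) := by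
      rw [h, map_mul, MulAut.mul_apply, sec_delta]
      group
    simp only [mul_assoc] at h2 ⊢
    rw [← mul_assoc (A.sec _ (A.actL (A.bd x) k)), h2]
    simp only [mul_assoc]

theorem liftedFun_one_left (n : A.EL) : A.liftedFun 1 n = n := by
  ext <;> simp [liftedFun, lift_one_left]

theorem liftedFun_mul_left (u v : A.GE) (n : A.EL) :
    A.liftedFun (u * v) n = A.liftedFun u (A.liftedFun v n) := by
  obtain ⟨g, x⟩ := u
  obtain ⟨h, y⟩ := v
  obtain ⟨e, k⟩ := n
  ext
  · simp only [liftedFun, RightSemidirect.mul_right, RightSemidirect.mul_left]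
    rw [map_mul A.actE, MulAut.mul_apply]
    congr 1
    simp [mul_assoc]
  · simp only [liftedFun, RightSemidirect.mul_right, RightSemidirect.mul_left]
    rw [map_mul A.actL, MulAut.mul_apply]
    congr 1
    have hb' : h * A.bd (A.actE h⁻¹ x) = A.bd x * h := by
      rw [A.bd_act]
      group
    have hb : h * A.bd (A.actE h⁻¹ x * y) = A.bd x * h * A.bd y := by
      rw [map_mul, ← mul_assoc, hb']
    have hx : A.actE h (A.actE h⁻¹ x) = x := by simp
    have he : (A.actE h (y * e * y⁻¹))⁻¹ = A.actE h (y * e⁻¹ * y⁻¹) := by simp [mul_assoc]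
    rw [A.lift_mul_left, map_mul (A.actL h), map_mul (A.actL h), A.act_lift, hx,
      ← MulAut.mul_apply, ← MulAut.mul_apply, ← map_mul, ← map_mul, hb, hb', he]
    simp [mul_assoc]

/-- The lifted action `•` of `G ⋉ E` on `{1} ⋉ (E ⋉ L) = E ⋉ L` by automorphisms,
`(g, x) • (e, k) = (g ▹ (x e x⁻¹), g ▹ ({x, e⁻¹} (∂ x ▹ k)))`. -/
def lifted : A.GE →* MulAut A.EL where
  toFun u :=
    { toFun := A.liftedFun u
      invFun := A.liftedFun u⁻¹
      left_inv := fun n => by rw [← liftedFun_mul_left, inv_mul_cancel, liftedFun_one_left]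
      right_inv := fun n => by rw [← liftedFun_mul_left, mul_inv_cancel, liftedFun_one_left]
      map_mul' := A.liftedFun_mul_right u }
  map_one' := by ext1 n; exact A.liftedFun_one_left n
  map_mul' u v := by ext1 n; exact A.liftedFun_mul_left u v n

/-- The underlying group `(G ⋉ E) ⋉ ({1} ⋉ (E ⋉ L))` of the triangle space. The element
`⟨⟨g, x⟩, ⟨z, w⟩⟩` is the tuple `(g, x, 1, z, w)`. -/
abbrev Triangle := RightSemidirect A.lifted

end Actions

section Homotopies

variable {L' E' F L E G : Type*} [Group L'] [Group E'] [Group F] [Group L] [Group E] [Group G]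

/-- Maps of 2-crossed modules `A' → A`. -/
@[ext] structure Hom (A' : TwoCrossedModule L' E' F) (A : TwoCrossedModule L E G) where
  μ : L' →* L
  ψ : E' →* E
  φ : F →* G
  comm_delta : ∀ l, ψ (A'.δ l) = A.δ (μ l)
  comm_bd : ∀ e, φ (A'.bd e) = A.bd (ψ e)
  map_lift : ∀ e f, μ (A'.lift e f) = A.lift (ψ e) (ψ f)
  map_actL : ∀ g l, μ (A'.actL g l) = A.actL (φ g) (μ l)
  map_actE : ∀ g e, ψ (A'.actE g e) = A.actE (φ g) (ψ e)

variable {A' : TwoCrossedModule L' E' F} {A : TwoCrossedModule L E G}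

/-- `s : F → E` is a `φ`-derivation: `s (g h) = (φ(h)⁻¹ ▹ s g) (s h)`. -/
def IsDerivation (A : TwoCrossedModule L E G) (φ : F →* G) (s : F → E) : Prop :=
  ∀ g h, s (g * h) = A.actE (φ h)⁻¹ (s g) * s h

/-- `(s, t)` is a quadratic `f`-derivation. -/
structure IsQuadraticDerivation (f : Hom A' A) (s : F → E) (t : E' → L) : Prop where
  derivation : A.IsDerivation f.φ s
  map_mul : ∀ a b, t (a * b) =
    A.sec (f.ψ b * s (A'.bd b))⁻¹
      (A.lift (f.ψ b) (A.actE (f.φ (A'.bd b)⁻¹) (s (A'.bd a))⁻¹) * t a) * t b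
  map_act : ∀ g a, t (A'.actE g a) =
    A.actL (f.φ g)
        (A.sec (s g * (s (A'.bd a))⁻¹) (A.lift (f.ψ a)⁻¹ (s g)⁻¹)⁻¹) *
      A.actL (f.φ g) (A.lift (s g) ((s (A'.bd a))⁻¹ * (f.ψ a)⁻¹)) *
      A.actL (f.φ g * A.bd (s g)) (t a)

/-- Homotopies `(f, s, t)` connecting `f` and `f'`. -/
@[ext] structure Homotopy (f f' : Hom A' A) where
  s : F → E
  t : E' → L
  isQuadraticDerivation : IsQuadraticDerivation f s t
  mu_eq : ∀ l, f'.μ l = f.μ l * t (A'.δ l)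
  psi_eq : ∀ a, f'.ψ a = f.ψ a * s (A'.bd a) * A.δ (t a)
  phi_eq : ∀ g, f'.φ g = f.φ g * A.bd (s g)

variable {ι : Type*}

/-- `s` is the unique `φ`-derivation with the values `s₀` on the basis `B`. -/
def IsTheDerivation (A : TwoCrossedModule L E G) (B : FreeGroupBasis ι F) (φ : F →* G)
    (s₀ : ι → E) (s : F → E) : Prop :=
  (A.IsDerivation φ s ∧ ∀ b, s (B b) = s₀ b) ∧
    ∀ σ : F → E, A.IsDerivation φ σ → (∀ b, σ (B b) = s₀ b) → σ = s

/-- The unique group map from `F` to the underlying group of the triangle space which is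
`b ↦ (φ b, s b, 1, s' b, 1)` on the basis `B`. -/
noncomputable def triangleMap (A : TwoCrossedModule L E G) (B : FreeGroupBasis ι F)
    (φ : F →* G) (s s' : F → E) : F →* A.Triangle :=
  B.lift fun b => ⟨⟨φ (B b), s (B b)⟩, ⟨s' (B b), 1⟩⟩

/-- The map `ω^{(s, s')} : F → L`, the last component of `triangleMap`. -/
noncomputable def omega (A : TwoCrossedModule L E G) (B : FreeGroupBasis ι F)
    (φ : F →* G) (s s' : F → E) (g : F) : L :=
  (A.triangleMap B φ s s' g).right.right

end Homotopies

end TwoCrossedModule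

/-! The pair `δ : L → E` is a categorical group: `l` is an arrow `e ⟶ e * δ l`, composition is
multiplication, and the Peiffer lifting is a crossed braiding. In this language the 2-crossed module
axioms become interchange, naturality and two hexagons, and a homotopy `(s, t)` consists of arrows
`t a : f.ψ a * s (∂ a) ⟶ f'.ψ a` compatible with products and with the action. The pointwise product
`s g * s' g` is generally not a derivation. Freeness of `F` supplies a derivation `σ` with the right
values on the basis, and arrows `ω g : σ g ⟶ s g * s' g` that are trivial on the basis and obey the
recursion of `IsConcatenation`. By `eq_of_recursion`, such arrows are determined by their basis
values. Concatenating homotopies is then pasting `ω`, `t` and `t'`. The pasting identities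
`concat_mul` and `concat_conjArrow` show that the pasted arrows satisfy the laws for `f` exactly
when `t'` satisfies them for `f'` (`isQuadraticDerivation_concatArrow_iff`). One direction gives
composites; the other gives inverses, because the only candidate for the inverse pastes with `t` to
the constant homotopy. Associativity holds because the fillings of both bracketings solve one
recursion (`IsConcatenation.whisker_assoc`). -/

namespace TwoCrossedModule

/-! ### The crossed braided categorical group of a 2-crossed module -/

section Whiskering

variable {L E G : Type*} [Group L] [Group E] [Group G] (A : TwoCrossedModule L E G)

/-- Right whiskering by `f` in the categorical group of `δ : L → E`, in which `l : L` is regarded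
as an arrow `e ⟶ e * δ l`. Left whiskering is trivial and composition is multiplication. -/
def whisker (f : E) : MulAut L := A.sec f⁻¹

/-- The crossed braiding `e * f ⟶ (∂ e ▹ f) * e`. -/
def braid (e f : E) : L := A.whisker e (A.lift e f⁻¹)

theorem whisker_mul (e f : E) (l : L) : A.whisker (e * f) l = A.whisker f (A.whisker e l) := by
  simp [whisker]

theorem whisker_one (l : L) : A.whisker 1 l = l := by
  simp [whisker]

theorem whisker_delta (k l : L) : A.whisker (A.δ k) l = k⁻¹ * l * k := by
  rw [whisker, ← map_inv A.δ, sec_delta, inv_inv]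

theorem delta_sec (e : E) (l : L) : A.δ (A.sec e l) = e * A.δ l * e⁻¹ := A.delta_secFun e l

theorem delta_whisker (e : E) (l : L) : A.δ (A.whisker e l) = e⁻¹ * A.δ l * e := by
  rw [whisker, delta_sec, inv_inv]

theorem act_whisker (g : G) (e : E) (l : L) :
    A.actL g (A.whisker e l) = A.whisker (A.actE g e) (A.actL g l) := by
  rw [whisker, whisker, act_sec, map_inv]

/-- The interchange law for `l` placed beside an arrow `k : f ⟶ f'`. -/
theorem whisker_mul_eq {f f' : E} {k : L} (h : f' = f * A.δ k) (l : L) :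
    A.whisker f l * k = k * A.whisker f' l := by
  rw [h, whisker_mul, whisker_delta]
  group

theorem delta_braid (e f : E) : A.δ (A.braid e f) = f⁻¹ * e⁻¹ * A.actE (A.bd e) f * e := by
  simp [braid, delta_whisker, A.delta_lift, mul_assoc]

theorem braid_one_left (f : E) : A.braid 1 f = 1 := by
  simp [braid, lift_one_left]

theorem braid_one_right (e : E) : A.braid e 1 = 1 := by
  simp [braid, lift_one_right]

theorem whisker_mul_braid (e f : E) (l : L) :
    A.whisker (e * f) l * A.braid e f = A.braid e f * A.whisker (A.actE (A.bd e) f * e) l :=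
  A.whisker_mul_eq (by rw [delta_braid]; group) l

/-- A hexagon: `e` is carried past `f` and then past `g`. The second braiding is whiskered only on
the left, which leaves it unchanged. -/
theorem braid_mul_right (e f g : E) :
    A.braid e (f * g) = A.whisker g (A.braid e f) * A.braid e g := by
  simp only [braid]
  rw [mul_inv_rev, lift_mul_right_sec, map_mul, ← whisker_mul, ← MulAut.mul_apply]
  have h : A.whisker e * A.sec (e * g⁻¹ * e⁻¹) = A.whisker (e * g) := by
    rw [whisker, whisker, ← map_mul]
    congr 1
    group
  rw [h]

theorem lift_delta_left (l : L) (e : E) : A.lift (A.δ l) e = l * A.sec e l⁻¹ := by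
  rw [sec_apply, map_inv, inv_inv, mul_inv_cancel_left]

theorem lift_delta_right (e : E) (l : L) :
    A.lift e (A.δ l) = A.sec e l * (A.actL (A.bd e) l)⁻¹ := by
  have h := A.lift_delta_mul e l
  rw [lift_delta_left, mul_assoc, mul_right_inj, map_inv, inv_mul_eq_iff_eq_mul, map_inv] at h
  exact h

/-- The other hexagon: `f` passes `g` first, after which `e` passes `∂ f ▹ g`. -/
theorem braid_mul_left (e f g : E) :
    A.braid (e * f) g = A.braid f g * A.whisker f (A.braid e (A.actE (A.bd f) g)) := by
  set k := A.lift f g⁻¹ with hk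
  -- The conjugate in the left product axiom differs from the acted element by `δ k`, so its lifting
  -- splits by the right product rule.
  have h1 : f * g⁻¹ * f⁻¹ = A.δ k * A.actE (A.bd f) g⁻¹ := by
    simp [hk, A.delta_lift, mul_assoc]
  have h2 : A.lift e (A.δ k) * A.actL (A.bd e) k = A.sec e k := by
    rw [lift_delta_right, inv_mul_cancel_right]
  have h3 : A.whisker e (A.sec e k) = k := by simp [whisker]
  have h4 : ∀ l : L, A.whisker e (A.sec (e * A.δ k * e⁻¹) l) = k * A.whisker e l * k⁻¹ := fun l => by
    rw [← A.sec_delta k, whisker, ← MulAut.mul_apply, ← MulAut.mul_apply, ← map_mul, ← map_mul]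
    congr 2
    group
  simp only [braid]
  rw [lift_mul_left, h1, lift_mul_right_sec, mul_assoc, ← hk, h2, whisker_mul, map_mul, h3, h4,
    inv_mul_cancel_right, map_mul, map_inv]

theorem braid_delta_left (l : L) (f : E) : A.braid (A.δ l) f = (A.whisker f l)⁻¹ * l := by
  rw [braid, lift_delta_left, whisker_delta, whisker, map_inv]
  group

theorem braid_delta_right (e : E) (k : L) :
    A.braid e (A.δ k) = k⁻¹ * A.whisker e (A.actL (A.bd e) k) := by
  rw [braid, ← map_inv, lift_delta_right, map_mul]
  simp [whisker]

/-- Naturality of the braiding in its first variable: the hexagon reduces it to the braiding of `δ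
l`. -/
theorem braid_natural_left (e f : E) (l : L) :
    A.whisker f l * A.braid (e * A.δ l) f = A.braid e f * l := by
  rw [braid_mul_left, braid_delta_left, whisker_delta, A.bd_delta, map_one, MulAut.one_apply]
  group

theorem braid_natural_right (e f : E) (k : L) :
    k * A.braid e (f * A.δ k) = A.braid e f * A.whisker e (A.actL (A.bd e) k) := by
  rw [braid_mul_right, braid_delta_right, whisker_delta]
  group

end Whiskering
-- Pasting identities behind the two laws of a quadratic derivation
section Pasting

variable {L E G : Type*} [Group L] [Group E] [Group G] (A : TwoCrossedModule L E G)

/-- Moving an arrow `M` past the braiding of `e * y * δ U` with `X`. -/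
theorem braid_inv_mul_whisker_mul_braid (e y X N : E) (M U : L) (hX : A.actE (A.bd y) X = N) :
    (A.braid y X)⁻¹ * A.whisker X (A.whisker y M * U) * A.braid (e * y * A.δ U) X =
      A.whisker y (A.whisker N M * A.braid e N) * U := by
  have h1 := A.whisker_mul_braid y X M
  rw [hX, whisker_mul, whisker_mul] at h1
  rw [map_mul, mul_assoc, mul_assoc, braid_natural_left, braid_mul_left, hX,
    inv_mul_eq_iff_eq_mul]
  simp only [← mul_assoc]
  rw [h1, map_mul]
  simp only [mul_assoc]

theorem whisker_braid_mul_whisker_braid (e X N x' : E) (T : L) (hN : A.actE (A.bd e) N = x') :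
    A.whisker N (A.braid e X * A.whisker e T) * A.braid e N =
      A.braid e (X * N) * A.whisker e (A.whisker x' T) := by
  have h1 := A.whisker_mul_braid e N T
  rw [hN, whisker_mul, whisker_mul] at h1
  rw [map_mul, mul_assoc, h1, braid_mul_right, mul_assoc]

/-- The multiplicativity law is compatible with the concatenation of arrows. -/
theorem concat_mul (e X X' N x' y y' S σ : E) (W w v T T' U U' : L)
    (hX' : A.actE (A.bd y) X' = N) (hN : A.actE (A.bd e) N = x') (hw : A.actL (A.bd e) W = w)
    (hW : S * A.δ W = X * N) (hv : y * y' = σ * A.δ v) :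
    A.whisker σ W * v * (A.whisker y' (A.braid y X'))⁻¹ *
        A.whisker (X' * y') (A.whisker y (A.braid e X * A.whisker e T) * U) *
        (A.whisker y' (A.braid (e * y * A.δ U) X' * A.whisker (e * y * A.δ U) T') * U') =
      A.whisker σ (A.braid e S * A.whisker e (w * A.whisker x' T * T')) *
        (v * A.whisker y' U * U') := by
  have hU : U * A.whisker (e * y * A.δ U) T' = A.whisker y (A.whisker e T') * U := by
    rw [← A.whisker_mul_eq rfl, whisker_mul]
  -- Naturality of the braiding along `W : S ⟶ X * N` trades the braiding with `X * N` for the one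
  -- with `S`.
  have hWM : W * (A.whisker N (A.braid e X * A.whisker e T) * A.braid e N) =
      A.braid e S * A.whisker e w * A.whisker e (A.whisker x' T) := by
    rw [A.whisker_braid_mul_whisker_braid e X N x' T hN, ← hW, ← mul_assoc,
      braid_natural_right, hw]
  calc _ = A.whisker σ W * v * A.whisker y' ((A.braid y X')⁻¹ *
            A.whisker X' (A.whisker y (A.braid e X * A.whisker e T) * U) *
            A.braid (e * y * A.δ U) X' * A.whisker (e * y * A.δ U) T') * U' := by
        rw [whisker_mul]
        simp only [map_mul (A.whisker y'), map_inv, mul_assoc]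
    _ = A.whisker σ W * v * A.whisker y' (A.whisker y
          (A.whisker N (A.braid e X * A.whisker e T) * A.braid e N * A.whisker e T') * U) *
            U' := by
        rw [A.braid_inv_mul_whisker_mul_braid e y X' N _ U hX', mul_assoc _ U, hU,
          ← mul_assoc _ _ U, ← map_mul]
    _ = A.whisker σ (W * (A.whisker N (A.braid e X * A.whisker e T) * A.braid e N) *
          A.whisker e T') * (v * A.whisker y' U * U') := by
        rw [map_mul (A.whisker y'), ← whisker_mul, ← mul_assoc, mul_assoc (A.whisker σ W), ←
          A.whisker_mul_eq hv]
        simp only [map_mul, mul_assoc]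
    _ = _ := by
        rw [hWM]
        simp only [map_mul, mul_assoc]

/-- The arrow `e * (∂ e⁻¹ ▹ x) * y * x⁻¹ ⟶ ∂ x ▹ (e * y * δ T)` in the equivariance law of a
quadratic derivation. -/
def conjArrow (e x y : E) (T : L) : L :=
  A.sec (x * y⁻¹) (A.lift e⁻¹ x⁻¹)⁻¹ * A.lift x (y⁻¹ * e⁻¹) * A.actL (A.bd x) T

theorem whisker_braid_inv_act (e x : E) :
    A.whisker e⁻¹ (A.braid e (A.actE (A.bd e)⁻¹ x)) = (A.braid e⁻¹ x)⁻¹ := by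
  have h := A.braid_mul_left e e⁻¹ x
  rw [mul_inv_cancel, braid_one_left, map_inv] at h
  exact (inv_eq_of_mul_eq_one_right h.symm).symm

/-- With `X = ∂ e⁻¹ ▹ x`, whiskering by `x` removes the trailing `x⁻¹` and exhibits the arrow as the
path `e * X * y ⟶ x * e * y ⟶ x * (e * y * δ T) ⟶ (∂ x ▹ (e * y * δ T)) * x`. -/
theorem whisker_conjArrow (e x y : E) (T : L) :
    A.whisker x (A.conjArrow e x y T) =
      A.whisker y (A.braid e (A.actE (A.bd e)⁻¹ x)) * T * A.braid x (e * y * A.δ T) := by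
  have h1 : A.whisker x (A.sec (x * y⁻¹) (A.lift e⁻¹ x⁻¹)⁻¹) =
      A.whisker y (A.braid e (A.actE (A.bd e)⁻¹ x)) := by
    have h2 : A.braid e (A.actE (A.bd e)⁻¹ x) = (A.lift e⁻¹ x⁻¹)⁻¹ := by
      apply (A.whisker e⁻¹).injective
      rw [whisker_braid_inv_act, braid, map_inv]
    rw [h2, map_mul]
    simp [whisker]
  have h3 : A.whisker x (A.lift x (y⁻¹ * e⁻¹)) = A.braid x (e * y) := by
    rw [braid, mul_inv_rev]
  rw [conjArrow, map_mul, map_mul, h1, h3, mul_assoc, ← braid_natural_right, ← mul_assoc]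

theorem delta_conjArrow (e x y : E) (T : L) :
    A.δ (A.conjArrow e x y T) =
      x * y⁻¹ * (A.actE (A.bd e)⁻¹ x)⁻¹ * e⁻¹ * A.actE (A.bd x) (e * y * A.δ T) := by
  have h : A.conjArrow e x y T = A.whisker x⁻¹ (A.whisker x (A.conjArrow e x y T)) := by
    rw [← whisker_mul, mul_inv_cancel, whisker_one]
  have hx : A.actE (A.bd e) (A.actE (A.bd e)⁻¹ x) = x := by simp
  rw [h, delta_whisker, whisker_conjArrow, map_mul A.δ, map_mul A.δ, delta_whisker, delta_braid,
    delta_braid, hx]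
  group

/-- The equivariance law is compatible with the concatenation of arrows. -/
theorem concat_conjArrow (e x y x' y' s σ n m X N S : E) (K w W v T T' : L)
    (hX : A.actE (A.bd e) X = x) (hN : A.actE (A.bd e) N = x')
    (hS : A.actE (A.bd e) S = s) (hn : A.actE (A.bd y) n = N) (hm : m = n * y' * x'⁻¹)
    (hw : A.actL (A.bd e) W = w) (hsw : x * x' = s * A.δ w)
    (hv : y * y' = σ * A.δ v)
    (hK : A.whisker s K * w * (A.whisker x' (A.braid x m))⁻¹ =
      A.whisker σ W * v * (A.whisker y' (A.braid y n))⁻¹) :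
    K * A.whisker (A.actE (A.bd x) m) (A.conjArrow e x y T) *
        A.actL (A.bd x) (A.conjArrow (e * y * A.δ T) x' y' T') =
      A.conjArrow e s σ (v * A.whisker y' T * T') := by
  obtain ⟨e', he'⟩ : ∃ e', e' = e * y * A.δ T := ⟨_, rfl⟩
  rw [← he']
  obtain ⟨H, hH⟩ : ∃ H, H = A.conjArrow e x y T := ⟨_, rfl⟩
  obtain ⟨H', hH'⟩ : ∃ H', H' = A.conjArrow e' x' y' T' := ⟨_, rfl⟩
  obtain ⟨Q, hQ⟩ : ∃ Q, Q = A.actE (A.bd x') (e' * y' * A.δ T') := ⟨_, rfl⟩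
  rw [← hH, ← hH']
  have hX' : A.actE (A.bd e)⁻¹ x = X := by rw [← hX]; simp
  have hn' : A.actE (A.bd e')⁻¹ x' = n := by
    rw [← hN, ← hn, he', map_mul, map_mul, A.bd_delta]; simp
  have h1 : A.whisker x H = A.whisker y (A.braid e X) * T * A.braid x e' := by
    rw [hH, whisker_conjArrow, hX', he']
  have h2 : A.whisker x' H' =
      A.whisker y' (A.braid e' n) * T' * A.braid x' (e' * y' * A.δ T') := by
    rw [hH', whisker_conjArrow, hn']
  have hQ' : m * A.δ H' = e'⁻¹ * Q := by
    rw [hH', delta_conjArrow, hm, hn', ← hQ]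
    group
  have h3 : n * y' * A.δ (A.whisker x' H') = e'⁻¹ * Q * x' := by
    rw [delta_whisker, ← hQ', hm]
    group
  have h4 : A.braid x m * A.whisker x (A.whisker (A.actE (A.bd x) m) H) =
      A.whisker m (A.whisker x H) * A.braid x m := by
    rw [← whisker_mul, ← whisker_mul, whisker_mul_braid]
  -- The two hexagons merge the braidings by `x` and by `x'` into a single braiding by `x * x'`.
  have h5 : A.whisker (n * y') (A.braid x e') * (A.whisker x' H' *
      A.whisker x' (A.braid x (e'⁻¹ * Q))) =
      A.whisker y' (A.braid e' n) * T' * A.braid (x * x') (e' * y' * A.δ T') := by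
    rw [← mul_assoc, A.whisker_mul_eq h3.symm, mul_assoc, whisker_mul, ← map_mul,
      ← braid_mul_right, mul_inv_cancel_left, h2, braid_mul_left, ← hQ]
    simp only [mul_assoc]
  have h6 : W * A.braid e (X * N) = A.braid e S * A.whisker e w := by
    have hXN : X * N = S * A.δ W := by
      apply (A.actE (A.bd e)).injective
      rw [map_mul, map_mul, hX, hN, hS, ← delta_act, hw, hsw]
    rw [hXN, braid_natural_right, hw]
  have h7 : A.whisker s K * w = A.whisker σ W * v * (A.whisker y' (A.braid y n))⁻¹ *
      A.whisker x' (A.braid x m) := by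
    rw [← hK, inv_mul_cancel_right]
  -- Whiskering by `s` and composing with `w : s ⟶ x * x'` loses no information and makes
  -- `whisker_conjArrow` applicable on both sides.
  apply (A.whisker s).injective
  apply mul_right_cancel (b := w)
  have hS' : A.actE (A.bd e)⁻¹ s = S := by rw [← hS]; simp
  have h8 : e' * y' * A.δ T' = e * σ * A.δ (v * A.whisker y' T * T') := by
    rw [he', map_mul, map_mul, delta_whisker]
    have : A.δ v = σ⁻¹ * (y * y') := by rw [hv]; group
    rw [this]
    group
  calc _ = A.whisker s K * w * A.whisker (x * x')
        (A.whisker (A.actE (A.bd x) m) H * A.actL (A.bd x) H') := by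
        rw [mul_assoc K, map_mul, mul_assoc, A.whisker_mul_eq hsw, ← mul_assoc]
    _ = A.whisker σ W * v * (A.whisker y' (A.braid y n))⁻¹ * A.whisker x'
          (A.braid x m * A.whisker x (A.whisker (A.actE (A.bd x) m) H) *
            A.whisker x (A.actL (A.bd x) H')) := by
        rw [h7, whisker_mul, map_mul (A.whisker x)]
        simp only [map_mul (A.whisker x'), mul_assoc]
    _ = A.whisker σ W * v * (A.whisker y' (A.braid y n))⁻¹ *
          (A.whisker (n * y') (A.whisker x H) *
            (A.whisker x' H' * A.whisker x' (A.braid x (e'⁻¹ * Q)))) := by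
        have hmx : n * y' = m * x' := by rw [hm]; group
        rw [h4, mul_assoc (A.whisker m _), ← braid_natural_right, hQ', map_mul, map_mul, hmx,
          whisker_mul]
    _ = A.whisker σ W * v * A.whisker y' ((A.braid y n)⁻¹ *
          A.whisker n (A.whisker y (A.braid e X) * T) * A.braid e' n) * T' *
          A.braid (x * x') (e' * y' * A.δ T') := by
        rw [h1, map_mul, mul_assoc (A.whisker (n * y') _), h5, whisker_mul]
        simp only [map_mul (A.whisker y'), map_inv, mul_assoc]
    _ = A.whisker σ (W * A.braid e (X * N)) * (v * A.whisker y' T * T') *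
          A.braid (x * x') (e' * y' * A.δ T') := by
        rw [he', A.braid_inv_mul_whisker_mul_braid e y n N _ T hn, ← braid_mul_right, map_mul (A.whisker y'),
          ← whisker_mul, ← mul_assoc, mul_assoc (A.whisker σ W), ← A.whisker_mul_eq hv]
        simp only [map_mul, mul_assoc]
    _ = A.whisker σ (A.braid e S) * ((v * A.whisker y' T * T') *
          A.whisker (e * σ * A.δ (v * A.whisker y' T * T')) w) *
          A.braid (x * x') (e' * y' * A.δ T') := by
        rw [h6, map_mul, ← whisker_mul, mul_assoc (A.whisker σ _),
          A.whisker_mul_eq (f := e * σ) (k := v * A.whisker y' T * T') rfl]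
    _ = _ := by
        rw [h8, whisker_conjArrow, hS', mul_assoc, mul_assoc, hsw,
          braid_natural_left]
        simp only [mul_assoc]

end Pasting
-- Derivations on a free group and the arrows filling their concatenation
section Concatenation

variable {F L E G ι : Type*} [Group F] [Group L] [Group E] [Group G]
  {A : TwoCrossedModule L E G} {φ φ' φ'' : F →* G} {s s' s'' σ σ' : F → E}

theorem IsDerivation.map_one (hs : A.IsDerivation φ s) : s 1 = 1 := by
  simpa using hs 1 1

theorem IsDerivation.map_inv (hs : A.IsDerivation φ s) (g : F) :
    s g⁻¹ = A.actE (φ g) (s g)⁻¹ := by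
  have h := hs g g⁻¹
  rw [mul_inv_cancel, hs.map_one, _root_.map_inv φ, inv_inv] at h
  rw [_root_.map_inv]
  exact (inv_eq_of_mul_eq_one_right h.symm).symm

theorem isDerivation_one : A.IsDerivation φ 1 := fun g h => by simp

/-- The homomorphism `F → G ⋉ E` of a derivation. -/
def IsDerivation.toHom (hs : A.IsDerivation φ s) : F →* A.GE :=
  MonoidHom.mk' (fun g => ⟨φ g, s g⟩) fun g h => by
    ext
    · simp
    · simpa using hs g h

/-- A `φ`-derivation is the second component of a homomorphism to `G ⋉ E` over `φ`, and
homomorphisms from `F` are determined on the basis. -/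
theorem IsDerivation.ext_basis (B : FreeGroupBasis ι F) (hs : A.IsDerivation φ s)
    (hσ : A.IsDerivation φ σ) (h : ∀ b, s (B b) = σ (B b)) : s = σ := by
  have key : hs.toHom = hσ.toHom := B.ext_hom _ _ fun b => by
    simp [IsDerivation.toHom, h]
  funext g
  exact congrArg RightSemidirect.right (DFunLike.congr_fun key g)

theorem IsDerivation.isTheDerivation (B : FreeGroupBasis ι F) (hs : A.IsDerivation φ s)
    {s₀ : ι → E} (h : ∀ b, s (B b) = s₀ b) : A.IsTheDerivation B φ s₀ s :=
  ⟨⟨hs, h⟩, fun _ hσ h' => hσ.ext_basis B hs fun b => by rw [h, h']⟩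

theorem exists_isDerivation (A : TwoCrossedModule L E G) (B : FreeGroupBasis ι F) (φ : F →* G)
    (s₀ : ι → E) : ∃ s, A.IsDerivation φ s ∧ ∀ b, s (B b) = s₀ b := by
  let X : F →* A.GE := B.lift fun b => ⟨φ (B b), s₀ b⟩
  have hX : ∀ g, (X g).left = φ g := by
    let p : F →* G := MonoidHom.mk' (fun g => (X g).left) fun g h => by simp
    have : p = φ := B.ext_hom _ _ fun b => by simp [p, X]
    exact DFunLike.congr_fun this
  refine ⟨fun g => (X g).right, fun g h => ?_, fun b => by simp [X]⟩
  simp [hX]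

/-- The recursion satisfied by arrows `w g : σ g ⟶ s g * s' g` filling in the concatenation of
the derivations `s` and `s'`. -/
structure IsConcatenation (A : TwoCrossedModule L E G) (φ : F →* G) (s s' σ : F → E)
    (w : F → L) : Prop where
  derivation : A.IsDerivation φ σ
  delta_eq : ∀ g, s g * s' g = σ g * A.δ (w g)
  map_mul : ∀ g h, w (g * h) = A.whisker (σ h) (A.actL (φ h)⁻¹ (w g)) * w h *
    (A.whisker (s' h) (A.braid (s h) (A.actE (φ h * A.bd (s h))⁻¹ (s' g))))⁻¹

/-- Translates the lifting that occurs in the action `•` into an inverse braiding; naturality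
absorbs `k`. This turns the product of the triangle group into the recursion of `IsConcatenation`.
-/
theorem whisker_lift_inv (A : TwoCrossedModule L E G) (x z f : E) (k w : L)
    (hf : A.actE (A.bd x) f = z) (hk : A.actL (A.bd x) k = w) :
    A.lift x⁻¹ z⁻¹ * k = A.whisker x w * (A.braid x (f * A.δ k))⁻¹ := by
  have hf' : A.actE (A.bd x)⁻¹ z = f := by rw [← hf]; simp
  have h := A.whisker_braid_inv_act x z
  have h1 : A.lift x⁻¹ z⁻¹ = (A.braid x f)⁻¹ := by
    apply (A.whisker x⁻¹).injective
    rw [← hf', _root_.map_inv (A.whisker x⁻¹), h, inv_inv, braid]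
  rw [h1, eq_mul_inv_iff_mul_eq, mul_assoc, braid_natural_right, hk, inv_mul_cancel_left]

/-- The derivation `s ⊗ s'`. -/
noncomputable def concat (A : TwoCrossedModule L E G) (B : FreeGroupBasis ι F) (φ : F →* G)
    (s s' : F → E) (g : F) : E :=
  s g * (A.triangleMap B φ s s' g).right.left

theorem omega_basis (B : FreeGroupBasis ι F) (b : ι) : A.omega B φ s s' (B b) = 1 := by
  simp [omega, triangleMap]

theorem concat_basis (B : FreeGroupBasis ι F) (b : ι) :
    A.concat B φ s s' (B b) = s (B b) * s' (B b) := by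
  simp [concat, triangleMap]

theorem triangleMap_left (B : FreeGroupBasis ι F) (hs : A.IsDerivation φ s) (g : F) :
    (A.triangleMap B φ s s' g).left = ⟨φ g, s g⟩ := by
  let p : F →* A.GE := MonoidHom.mk' (fun g => (A.triangleMap B φ s s' g).left) fun g h => by simp
  have : p = hs.toHom := B.ext_hom _ _ fun b => by simp [p, triangleMap, IsDerivation.toHom]
  exact DFunLike.congr_fun this g

theorem triangleMap_mul_right_left (B : FreeGroupBasis ι F) (hs : A.IsDerivation φ s) (g h : F) :
    (A.triangleMap B φ s s' (g * h)).right.left =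
      (s h)⁻¹ * A.actE (φ h)⁻¹ (A.triangleMap B φ s s' g).right.left * s h *
        (A.triangleMap B φ s s' h).right.left := by
  simp [triangleMap_left B hs, lifted, liftedFun, mul_assoc]

theorem omega_mul (B : FreeGroupBasis ι F) (hs : A.IsDerivation φ s) (g h : F) :
    A.omega B φ s s' (g * h) =
      A.whisker (A.triangleMap B φ s s' h).right.left
        (A.lift (s h)⁻¹ (A.actE (φ h)⁻¹ (A.triangleMap B φ s s' g).right.left)⁻¹ *
          A.actL (φ h * A.bd (s h))⁻¹ (A.omega B φ s s' g)) * A.omega B φ s s' h := by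
  have key : A.omega B φ s s' (g * h) =
      A.whisker (A.triangleMap B φ s s' h).right.left
        (A.liftedFun (A.triangleMap B φ s s' h).left⁻¹ (A.triangleMap B φ s s' g).right).right *
          A.omega B φ s s' h := by
    rw [omega, _root_.map_mul]
    rfl
  have hb : (φ h)⁻¹ * A.bd (A.actE (φ h) (s h)⁻¹) = (φ h * A.bd (s h))⁻¹ := by
    rw [A.bd_act, _root_.map_inv]
    group
  have hx : A.actE (φ h)⁻¹ (A.actE (φ h) (s h)⁻¹) = (s h)⁻¹ := by simp
  rw [key, triangleMap_left B hs]
  simp only [liftedFun, RightSemidirect.inv_left, RightSemidirect.inv_right]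
  rw [_root_.map_mul (A.actL _), A.act_lift, hx, ← MulAut.mul_apply, ← _root_.map_mul A.actL, hb,
    _root_.map_inv (A.actE _)]
  rfl

/-- The right-hand side is again a `φ'`-derivation, and it agrees with `s'` on the basis. -/
theorem triangleMap_delta_omega (B : FreeGroupBasis ι F) (hs : A.IsDerivation φ s)
    (hφ : ∀ g, φ' g = φ g * A.bd (s g)) (hs' : A.IsDerivation φ' s') (g : F) :
    s' g = (A.triangleMap B φ s s' g).right.left * A.δ (A.omega B φ s s' g) := by
  have key : A.IsDerivation φ' fun g =>
      (A.triangleMap B φ s s' g).right.left * A.δ (A.omega B φ s s' g) := fun g h => by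
    have hx : A.actE (φ' h)⁻¹ = A.actE (A.bd (s h))⁻¹ * A.actE (φ h)⁻¹ := by
      rw [hφ, mul_inv_rev, _root_.map_mul]
    dsimp only
    rw [omega_mul B hs, triangleMap_mul_right_left B hs, ← hφ, _root_.map_mul A.δ,
      delta_whisker, _root_.map_mul A.δ, A.delta_lift, A.delta_act, hx, inv_inv, MulAut.mul_apply,
      MulAut.mul_apply, _root_.map_mul, _root_.map_mul, _root_.map_inv A.bd]
    group
  exact congrFun (hs'.ext_basis B key fun b => by simp [triangleMap, omega]) g

theorem isConcatenation_concat (B : FreeGroupBasis ι F) (hs : A.IsDerivation φ s)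
    (hφ : ∀ g, φ' g = φ g * A.bd (s g)) (hs' : A.IsDerivation φ' s') :
    A.IsConcatenation φ s s' (A.concat B φ s s') (A.omega B φ s s') where
  derivation g h := by
    rw [concat, triangleMap_mul_right_left B hs, hs, concat, concat, _root_.map_mul]
    group
  delta_eq g := by
    rw [triangleMap_delta_omega B hs hφ hs', concat, mul_assoc]
  map_mul g h := by
    set X := A.triangleMap B φ s s' with hX
    set w := A.omega B φ s s' with hw
    have h1 : A.actE (φ h * A.bd (s h))⁻¹ (s' g) =
        A.actE (φ h * A.bd (s h))⁻¹ (X g).right.left *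
          A.δ (A.actL (φ h * A.bd (s h))⁻¹ (w g)) := by
      rw [triangleMap_delta_omega B hs hφ hs' g, _root_.map_mul, A.delta_act]
    have h2 : s' h = (X h).right.left * A.δ (w h) := triangleMap_delta_omega B hs hφ hs' h
    have h3 := A.whisker_lift_inv (s h) (A.actE (φ h)⁻¹ (X g).right.left)
      (A.actE (φ h * A.bd (s h))⁻¹ (X g).right.left) (A.actL (φ h * A.bd (s h))⁻¹ (w g))
      (A.actL (φ h)⁻¹ (w g)) (by simp) (by simp)
    rw [← h1] at h3
    have h4 : A.concat B φ s s' h = s h * (X h).right.left := rfl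
    rw [hw, omega_mul B hs, ← hw, ← hX, h3, h4, whisker_mul, mul_assoc (A.whisker _ _) (w h),
      ← _root_.map_inv (A.whisker _), ← A.whisker_mul_eq h2, ← mul_assoc, ← _root_.map_mul]

/-- The correction `K` is common to both maps, so the set where they agree is a subgroup, and it
contains the basis. -/
theorem eq_of_recursion (B : FreeGroupBasis ι F)
    (hσ : A.IsDerivation φ σ) {v w : F → L} (K : F → F → L)
    (hv : ∀ g h, v (g * h) = A.whisker (σ h) (A.actL (φ h)⁻¹ (v g)) * v h * K g h)
    (hw : ∀ g h, w (g * h) = A.whisker (σ h) (A.actL (φ h)⁻¹ (w g)) * w h * K g h)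
    (h : ∀ b, v (B b) = w (B b)) : v = w := by
  -- The value at `1` need not be prescribed: the recursion at `(1, 1)` forces it.
  have one_eq : ∀ u : F → L,
      (∀ g h, u (g * h) = A.whisker (σ h) (A.actL (φ h)⁻¹ (u g)) * u h * K g h) →
      u 1 = (K 1 1)⁻¹ := fun u hu => by
    have := hu 1 1
    rw [hσ.map_one, _root_.map_one φ, whisker_one, mul_one, inv_one, _root_.map_one, MulAut.one_apply] at this
    rw [mul_assoc, left_eq_mul] at this
    exact eq_inv_of_mul_eq_one_left this
  let S : Subgroup F :=
    { carrier := {g | v g = w g}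
      mul_mem' := fun {a b} ha hb => by
        rw [Set.mem_ofPred_eq] at *
        rw [hv, hw, ha, hb]
      one_mem' := by
        rw [Set.mem_ofPred_eq, one_eq v hv, one_eq w hw]
      inv_mem' := fun {a} ha => by
        rw [Set.mem_ofPred_eq] at *
        have h1 := hv a⁻¹ a
        have h2 := hw a⁻¹ a
        rw [inv_mul_cancel, one_eq v hv, ha] at h1
        rw [inv_mul_cancel, one_eq w hw, h1] at h2
        simpa using h2 }
  -- Freeness gives a map into `S` that fixes the basis; its composite with the inclusion is the
  -- identity, so `S` is all of `F`.
  let r : F →* S := B.lift fun b => ⟨B b, h b⟩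
  have hr : S.subtype.comp r = MonoidHom.id F := B.ext_hom _ _ fun b => by simp [r]
  funext g
  have hg : g ∈ S := by
    rw [show g = r g from (DFunLike.congr_fun hr g).symm]
    exact (r g).2
  exact hg

end Concatenation
-- The fillings of the two bracketings of a triple concatenation
section Associativity

variable {L E G : Type*} [Group L] [Group E] [Group G] (A : TwoCrossedModule L E G)

/-- Brings the recursion for the left bracketing to a form whose last factor contains only
braidings. Interchange and naturality suffice. -/
theorem assoc_recursion_left (Z σ S S' S'' P p p' : E) (b β α M : L)
    (hp : A.actE (A.bd σ) p = P) (hα : S * S' = σ * A.δ α) (hβ : σ * S'' = Z * A.δ β) :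
    A.whisker Z b * β * (A.whisker S'' (A.braid σ p))⁻¹ *
        A.whisker (p * S'') (A.whisker σ M * α * (A.whisker S' (A.braid S p'))⁻¹) =
      A.whisker Z (b * A.whisker P M) * (β * A.whisker S'' α) *
        A.whisker S'' ((A.braid (S * S') p)⁻¹ * (A.whisker (S' * p) (A.braid S p'))⁻¹) := by
  have h1 : (A.braid σ p)⁻¹ * A.whisker p (A.whisker σ M) =
      A.whisker σ (A.whisker P M) * (A.braid σ p)⁻¹ := by
    rw [inv_mul_eq_iff_eq_mul, ← mul_assoc, eq_mul_inv_iff_mul_eq, ← whisker_mul, ← whisker_mul,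
      whisker_mul_braid, hp]
  have h2 : (A.braid σ p)⁻¹ * A.whisker p α = α * (A.braid (S * S') p)⁻¹ := by
    rw [inv_mul_eq_iff_eq_mul, ← mul_assoc, eq_mul_inv_iff_mul_eq, hα, braid_natural_left]
  calc _ = A.whisker Z b * β * A.whisker S'' ((A.braid σ p)⁻¹ *
          A.whisker p (A.whisker σ M * α * (A.whisker S' (A.braid S p'))⁻¹)) := by
        rw [whisker_mul A p, map_mul (A.whisker S''), map_inv (A.whisker S''), mul_assoc, mul_assoc,
          mul_assoc]
    _ = A.whisker Z b * β * (A.whisker (σ * S'') (A.whisker P M) * A.whisker S''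
          (α * (A.braid (S * S') p)⁻¹ * (A.whisker (S' * p) (A.braid S p'))⁻¹)) := by
        rw [map_mul (A.whisker p), map_mul (A.whisker p), ← mul_assoc, ← mul_assoc, h1,
          mul_assoc (A.whisker σ _), h2, whisker_mul A σ S'', whisker_mul A S' p,
          ← map_inv (A.whisker p), mul_assoc (A.whisker σ _), map_mul]
    _ = _ := by
        rw [mul_assoc (A.whisker Z b), ← mul_assoc β, ← A.whisker_mul_eq hβ, map_mul (A.whisker Z)]
        simp only [map_mul, mul_assoc]

/-- The right bracketing reaches the same last factor, here with the help of both hexagons, since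
the braiding by `S` meets the product `p' * (∂ S' ▹ p)`. -/
theorem assoc_recursion_right (Z σ S S' S'' q p p' : E) (b ε γ Γ Γ' : L)
    (hΓ : A.actL (A.bd S) Γ' = Γ) (hq : q * A.δ Γ' = p' * A.actE (A.bd S') p)
    (hε : S * σ = Z * A.δ ε) (hγ : S' * S'' = σ * A.δ γ) :
    A.whisker Z b * ε * (A.whisker σ (A.braid S q))⁻¹ *
        (A.whisker σ Γ' * γ * (A.whisker S'' (A.braid S' p))⁻¹) =
      A.whisker Z (b * Γ) * (ε * γ) *
        A.whisker S'' ((A.braid (S * S') p)⁻¹ * (A.whisker (S' * p) (A.braid S p'))⁻¹) := by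
  have h1 : (A.braid S q)⁻¹ * Γ' =
      A.whisker S Γ * (A.braid S (p' * A.actE (A.bd S') p))⁻¹ := by
    rw [inv_mul_eq_iff_eq_mul, ← mul_assoc, eq_mul_inv_iff_mul_eq, ← hq, braid_natural_right, hΓ]
  have h2 : (A.whisker S' (A.braid S (p' * A.actE (A.bd S') p)))⁻¹ * (A.braid S' p)⁻¹ =
      (A.braid (S * S') p)⁻¹ * (A.whisker (S' * p) (A.braid S p'))⁻¹ := by
    rw [← mul_inv_rev, ← mul_inv_rev, inv_inj, braid_mul_right, braid_mul_left, map_mul,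
      ← mul_assoc, ← mul_assoc, ← whisker_mul, whisker_mul_braid]
  calc _ = A.whisker Z b * ε * (A.whisker σ ((A.braid S q)⁻¹ * Γ') * γ *
        (A.whisker S'' (A.braid S' p))⁻¹) := by
        rw [map_mul, map_inv]
        simp only [mul_assoc]
    _ = A.whisker Z b * (ε * A.whisker (S * σ) Γ) * γ * A.whisker S''
          ((A.whisker S' (A.braid S (p' * A.actE (A.bd S') p)))⁻¹ * (A.braid S' p)⁻¹) := by
        rw [h1, map_mul (A.whisker σ), mul_assoc (A.whisker σ _), A.whisker_mul_eq hγ,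
          whisker_mul A S σ, whisker_mul A S' S'']
        simp only [map_mul, map_inv, mul_assoc]
    _ = _ := by
        rw [h2, ← A.whisker_mul_eq hε, map_mul (A.whisker Z)]
        simp only [mul_assoc]

variable {F ι : Type*} [Group F] {A} {φ φ' φ'' : F →* G} {s s' s'' σ σ' ρ : F → E}
  {v v' w w' : F → L}

theorem IsConcatenation.omega_unique (B : FreeGroupBasis ι F) (hs : A.IsDerivation φ s)
    (hφ : ∀ g, φ' g = φ g * A.bd (s g)) (hs' : A.IsDerivation φ' s')
    (h : A.IsConcatenation φ s s' σ w) (hw : ∀ b, w (B b) = 1) :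
    σ = A.concat B φ s s' ∧ w = A.omega B φ s s' := by
  have h' := isConcatenation_concat B hs hφ hs'
  have hσ : σ = A.concat B φ s s' := h.derivation.ext_basis B h'.derivation fun b => by
    have := h.delta_eq (B b)
    rw [hw, _root_.map_one, mul_one] at this
    rw [← this, concat_basis]
  subst hσ
  exact ⟨rfl,
    eq_of_recursion B h.derivation _ h.map_mul h'.map_mul fun b => by rw [hw, omega_basis]⟩

/-- Both sides fill `ρ g ⟶ s g * s' g * s'' g`, satisfy the same recursion and are trivial on the
basis. -/
theorem IsConcatenation.whisker_assoc (B : FreeGroupBasis ι F)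
    (hφ : ∀ g, φ' g = φ g * A.bd (s g)) (hφ' : ∀ g, φ'' g = φ' g * A.bd (s' g))
    (hs'' : A.IsDerivation φ'' s'')
    (hv : A.IsConcatenation φ s s' σ v) (hw : A.IsConcatenation φ σ s'' ρ w)
    (hv' : A.IsConcatenation φ' s' s'' σ' v') (hw' : A.IsConcatenation φ s σ' ρ w')
    (bv : ∀ b, v (B b) = 1) (bw : ∀ b, w (B b) = 1)
    (bv' : ∀ b, v' (B b) = 1) (bw' : ∀ b, w' (B b) = 1) (g : F) :
    w g * A.whisker (s'' g) (v g) = w' g * v' g := by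
  have hσ : ∀ g, φ'' g = φ g * A.bd (σ g) := fun g => by
    have := congrArg A.bd (hv.delta_eq g)
    rw [_root_.map_mul, _root_.map_mul, A.bd_delta, mul_one] at this
    rw [hφ', hφ, ← this, mul_assoc]
  refine congrFun (eq_of_recursion (v := fun g => w g * A.whisker (s'' g) (v g))
    (w := fun g => w' g * v' g) B hw.derivation
    (fun g h => A.whisker (s'' h) ((A.braid (s h * s' h) (A.actE (φ'' h)⁻¹ (s'' g)))⁻¹ *
      (A.whisker (s' h * (A.actE (φ'' h)⁻¹ (s'' g)))
        (A.braid (s h) (A.actE (φ' h)⁻¹ (s' g))))⁻¹)) (fun g h => ?_) (fun g h => ?_) ?_) g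
  · rw [hw.map_mul, hv.map_mul, hs'', ← hσ, ← hφ, _root_.map_mul (A.actL _), act_whisker]
    refine A.assoc_recursion_left _ _ _ _ _ _ _ _ _ _ _ _ ?_ (hv.delta_eq h) (hw.delta_eq h)
    rw [hσ, mul_inv_rev, _root_.map_mul, MulAut.mul_apply]
    simp
  · rw [hw'.map_mul, hv'.map_mul, ← hφ, ← hφ', _root_.map_mul (A.actL _)]
    refine A.assoc_recursion_right _ _ _ _ _ _ _ _ _ _ _ _ _ ?_ ?_ (hw'.delta_eq h)
      (hv'.delta_eq h)
    · rw [hφ, mul_inv_rev, _root_.map_mul, MulAut.mul_apply]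
      simp
    · rw [A.delta_act, ← _root_.map_mul (A.actE _), ← hv'.delta_eq, _root_.map_mul, hφ' h, mul_inv_rev,
        _root_.map_mul A.actE, MulAut.mul_apply]
      simp
  · intro b
    simp [bv, bw, bv', bw']

theorem isConcatenation_one_left (hs : A.IsDerivation φ s) :
    A.IsConcatenation φ 1 s s 1 where
  derivation := hs
  delta_eq g := by simp
  map_mul g h := by simp [braid_one_left]

theorem isConcatenation_one_right (hs : A.IsDerivation φ s) :
    A.IsConcatenation φ s 1 s 1 where
  derivation := hs
  delta_eq g := by simp
  map_mul g h := by simp [braid_one_right]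

end Associativity

/-! ### Concatenation, units and inverses of homotopies -/

section Homotopy

variable {L' E' F L E G ι : Type*} [Group L'] [Group E'] [Group F] [Group L] [Group E] [Group G]
  {A' : TwoCrossedModule L' E' F} {A : TwoCrossedModule L E G} {f f' f'' f''' : Hom A' A}
  {s s' σ : F → E} {t t' : E' → L} {w : F → L}

theorem mul_law_eq (f : Hom A' A) (s : F → E) (t : E' → L) (a b : E') :
    A.sec (f.ψ b * s (A'.bd b))⁻¹
        (A.lift (f.ψ b) (A.actE (f.φ (A'.bd b)⁻¹) (s (A'.bd a))⁻¹) * t a) * t b =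
      A.whisker (s (A'.bd b)) (A.braid (f.ψ b) (A.actE (A.bd (f.ψ b))⁻¹ (s (A'.bd a))) *
        A.whisker (f.ψ b) (t a)) * t b := by
  rw [braid, ← map_mul (A.whisker (f.ψ b)), ← whisker_mul, map_inv f.φ, f.comm_bd,
    map_inv (A.actE _) (s _)]
  rfl

theorem act_law_eq (f : Hom A' A) (s : F → E) (t : E' → L) (g : F) (a : E') :
    A.actL (f.φ g) (A.sec (s g * (s (A'.bd a))⁻¹) (A.lift (f.ψ a)⁻¹ (s g)⁻¹)⁻¹) *
        A.actL (f.φ g) (A.lift (s g) ((s (A'.bd a))⁻¹ * (f.ψ a)⁻¹)) *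
        A.actL (f.φ g * A.bd (s g)) (t a) =
      A.actL (f.φ g) (A.conjArrow (f.ψ a) (s g) (s (A'.bd a)) (t a)) := by
  rw [conjArrow, map_mul A.actL, MulAut.mul_apply, map_mul (A.actL _), map_mul (A.actL _)]

/-- The second component of the concatenation of homotopies. -/
def concatArrow (A' : TwoCrossedModule L' E' F) (A : TwoCrossedModule L E G) (s' : F → E)
    (w : F → L) (t t' : E' → L) (a : E') : L :=
  w (A'.bd a) * A.whisker (s' (A'.bd a)) (t a) * t' a

/-- The last factor on the left is what the product law for `f'` prescribes for `t' (a * b)`. Hence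
the laws for `t'` and for the pasted arrow differ by a cancellable left factor. -/
theorem concatArrow_mul (hφ : ∀ g, f'.φ g = f.φ g * A.bd (s g))
    (hψ : ∀ a, f'.ψ a = f.ψ a * s (A'.bd a) * A.δ (t a)) (h : IsQuadraticDerivation f s t)
    (hs' : A.IsDerivation f'.φ s') (hw : A.IsConcatenation f.φ s s' σ w) (a b : E') :
    w (A'.bd (a * b)) * A.whisker (s' (A'.bd (a * b))) (t (a * b)) *
      (A.whisker (s' (A'.bd b)) (A.braid (f'.ψ b) (A.actE (A.bd (f'.ψ b))⁻¹ (s' (A'.bd a))) *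
        A.whisker (f'.ψ b) (t' a)) * t' b) =
      A.whisker (σ (A'.bd b)) (A.braid (f.ψ b) (A.actE (A.bd (f.ψ b))⁻¹ (σ (A'.bd a))) *
        A.whisker (f.ψ b) (concatArrow A' A s' w t t' a)) * concatArrow A' A s' w t t' b := by
  have hb : A.bd (f'.ψ b) = A.bd (f.ψ b) * A.bd (s (A'.bd b)) := by
    rw [← f'.comm_bd, hφ, f.comm_bd]
  rw [h.map_mul, mul_law_eq, map_mul A'.bd, hs', hw.map_mul, ← hφ, f.comm_bd, f'.comm_bd, hψ b]
  refine A.concat_mul (f.ψ b) _ (A.actE (A.bd (f.ψ b * s (A'.bd b) * A.δ (t b)))⁻¹ (s' (A'.bd a)))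
    (A.actE (A.bd (f.ψ b))⁻¹ (s' (A'.bd a))) (s' (A'.bd a)) _ _ _ _ _ _ _ _ _ _ _
    ?_ (by simp) (by simp) ?_ (hw.delta_eq _)
  · rw [← hψ, hb, mul_inv_rev, map_mul A.actE, MulAut.mul_apply]
    simp
  · rw [A.delta_act, ← map_mul, ← map_mul, hw.delta_eq]

theorem concatArrow_act (hφ : ∀ g, f'.φ g = f.φ g * A.bd (s g))
    (hψ : ∀ a, f'.ψ a = f.ψ a * s (A'.bd a) * A.δ (t a)) (h : IsQuadraticDerivation f s t)
    (hs' : A.IsDerivation f'.φ s') (hw : A.IsConcatenation f.φ s s' σ w) (g : F) (a : E') :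
    w (A'.bd (A'.actE g a)) * A.whisker (s' (A'.bd (A'.actE g a))) (t (A'.actE g a)) *
      A.actL (f'.φ g) (A.conjArrow (f'.ψ a) (s' g) (s' (A'.bd a)) (t' a)) =
      A.actL (f.φ g) (A.conjArrow (f.ψ a) (σ g) (σ (A'.bd a))
        (concatArrow A' A s' w t t' a)) := by
  have hb : A.bd (f'.ψ a) = A.bd (f.ψ a) * A.bd (s (A'.bd a)) := by
    rw [← f'.comm_bd, hφ, f.comm_bd]
  obtain ⟨n, hn⟩ : ∃ n, n = A.actE (A.bd (f'.ψ a))⁻¹ (s' g) := ⟨_, rfl⟩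
  obtain ⟨m, hm⟩ : ∃ m, m = n * s' (A'.bd a) * (s' g)⁻¹ := ⟨_, rfl⟩
  obtain ⟨k, hk⟩ : ∃ k, k = A'.bd (A'.actE g a) := ⟨_, rfl⟩
  have hkg : k * g = g * A'.bd a := by rw [hk, A'.bd_act, inv_mul_cancel_right]
  have hsk : A.actE (f'.φ g)⁻¹ (s' k) = m := by
    have h1 := hs' k g
    rw [hkg, hs', f'.comm_bd, ← hn] at h1
    rw [hm, h1, mul_inv_cancel_right]
  have hsk' : s' k = A.actE (f.φ g) (A.actE (A.bd (s g)) m) := by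
    rw [← MulAut.mul_apply, ← map_mul, ← hφ, ← hsk]
    simp
  -- Since `k * g = g * ∂ a`, the recursion evaluates `w` there in two ways; their equality is the
  -- compatibility required of `K` in `concat_conjArrow`.
  have hwk := hw.map_mul k g
  rw [hkg, hw.map_mul, ← hφ, ← hφ, hsk, f'.comm_bd, ← hn] at hwk
  have key := A.concat_conjArrow (f.ψ a) (s g) (s (A'.bd a)) (s' g) (s' (A'.bd a)) (σ g)
    (σ (A'.bd a)) n m (A.actE (A.bd (f.ψ a))⁻¹ (s g)) (A.actE (A.bd (f.ψ a))⁻¹ (s' g))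
    (A.actE (A.bd (f.ψ a))⁻¹ (σ g)) (A.actL (f.φ g)⁻¹ (w k)) (w g)
    (A.actL (A.bd (f.ψ a))⁻¹ (w g)) (w (A'.bd a)) (t a) (t' a) (by simp) (by simp) (by simp)
    (by rw [hn, hb, mul_inv_rev, map_mul A.actE, MulAut.mul_apply]; simp) hm (by simp)
    (hw.delta_eq _) (hw.delta_eq _) (by rw [← hwk, f.comm_bd])
  rw [h.map_act, act_law_eq, ← hk, concatArrow, ← key, hsk', hφ, hψ a, ← act_whisker,
    map_mul A.actL, MulAut.mul_apply, map_mul (A.actL (f.φ g)), map_mul (A.actL (f.φ g))]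
  simp

/-- `f'` and `f` enter without a homotopy out of `f'` being given, so the forward direction can
construct one: this is how inverses arise. -/
theorem isQuadraticDerivation_concatArrow_iff (hφ : ∀ g, f'.φ g = f.φ g * A.bd (s g))
    (hψ : ∀ a, f'.ψ a = f.ψ a * s (A'.bd a) * A.δ (t a)) (h : IsQuadraticDerivation f s t)
    (hs' : A.IsDerivation f'.φ s') (hw : A.IsConcatenation f.φ s s' σ w) :
    IsQuadraticDerivation f σ (concatArrow A' A s' w t t') ↔ IsQuadraticDerivation f' s' t' := by
  constructor
  · intro hσ
    refine ⟨hs', fun a b => ?_, fun g a => ?_⟩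
    · have h1 := hσ.map_mul a b
      rw [mul_law_eq, ← concatArrow_mul hφ hψ h hs' hw, concatArrow, mul_right_inj] at h1
      rw [mul_law_eq, h1]
    · have h1 := hσ.map_act g a
      rw [act_law_eq, ← concatArrow_act hφ hψ h hs' hw, concatArrow, mul_right_inj] at h1
      rw [act_law_eq, h1]
  · intro h'
    refine ⟨hw.derivation, fun a b => ?_, fun g a => ?_⟩
    · rw [mul_law_eq, ← concatArrow_mul hφ hψ h hs' hw, concatArrow, h'.map_mul, mul_law_eq]
    · rw [act_law_eq, ← concatArrow_act hφ hψ h hs' hw, concatArrow, h'.map_act, act_law_eq]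

theorem isQuadraticDerivation_one (f : Hom A' A) :
    IsQuadraticDerivation f (1 : F → E) (1 : E' → L) where
  derivation := isDerivation_one
  map_mul a b := by simp [lift_one_right]
  map_act g a := by simp [lift_one_left, lift_one_right]

/-- The constant homotopy at `f`. -/
def Homotopy.refl (f : Hom A' A) : Homotopy f f where
  s := 1
  t := 1
  isQuadraticDerivation := isQuadraticDerivation_one f
  mu_eq l := by simp
  psi_eq a := by simp
  phi_eq g := by simp

theorem Homotopy.isConcatenation (B : FreeGroupBasis ι F) (h : Homotopy f f')
    (h' : Homotopy f' f'') :
    A.IsConcatenation f.φ h.s h'.s (A.concat B f.φ h.s h'.s) (A.omega B f.φ h.s h'.s) :=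
  isConcatenation_concat B h.isQuadraticDerivation.derivation h.phi_eq
    h'.isQuadraticDerivation.derivation

/-- The concatenation of homotopies. -/
noncomputable def Homotopy.trans (B : FreeGroupBasis ι F) (h : Homotopy f f')
    (h' : Homotopy f' f'') : Homotopy f f'' where
  s := A.concat B f.φ h.s h'.s
  t := concatArrow A' A h'.s (A.omega B f.φ h.s h'.s) h.t h'.t
  isQuadraticDerivation :=
    (isQuadraticDerivation_concatArrow_iff h.phi_eq h.psi_eq h.isQuadraticDerivation
      h'.isQuadraticDerivation.derivation (h.isConcatenation B h')).2 h'.isQuadraticDerivation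
  mu_eq l := by
    have hw : A.omega B f.φ h.s h'.s 1 = 1 := by simp [omega]
    rw [concatArrow, A'.bd_delta, hw, h'.isQuadraticDerivation.derivation.map_one, whisker_one,
      one_mul, h'.mu_eq, h.mu_eq, mul_assoc]
  psi_eq a := by
    have hw := (h.isConcatenation B h').delta_eq (A'.bd a)
    rw [concatArrow, map_mul, map_mul, delta_whisker, h'.psi_eq, h.psi_eq,
      ← inv_mul_eq_iff_eq_mul.2 hw]
    group
  phi_eq g := by
    have hw := congrArg A.bd ((h.isConcatenation B h').delta_eq g)
    rw [map_mul, map_mul, A.bd_delta, mul_one] at hw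
    rw [h'.phi_eq, h.phi_eq, ← hw, mul_assoc]

theorem Homotopy.trans_eq (B : FreeGroupBasis ι F) {h : Homotopy f f'} {h' : Homotopy f' f''}
    {k : Homotopy f f''} (hw : A.IsConcatenation f.φ h.s h'.s k.s w) (hb : ∀ b, w (B b) = 1)
    (ht : ∀ a, concatArrow A' A h'.s w h.t h'.t a = k.t a) : h.trans B h' = k := by
  obtain ⟨h1, h2⟩ := hw.omega_unique B h.isQuadraticDerivation.derivation h.phi_eq
    h'.isQuadraticDerivation.derivation hb
  ext a
  · exact congrFun h1.symm a
  · rw [← ht, h2]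
    rfl

theorem Homotopy.refl_trans (B : FreeGroupBasis ι F) (h : Homotopy f f') :
    (Homotopy.refl f).trans B h = h :=
  Homotopy.trans_eq B (isConcatenation_one_left h.isQuadraticDerivation.derivation)
    (fun _ => rfl) fun a => by simp [concatArrow, Homotopy.refl]

theorem Homotopy.trans_refl (B : FreeGroupBasis ι F) (h : Homotopy f f') :
    h.trans B (Homotopy.refl f') = h :=
  Homotopy.trans_eq B (isConcatenation_one_right h.isQuadraticDerivation.derivation)
    (fun _ => rfl) fun a => by simp [concatArrow, Homotopy.refl, whisker_one]

theorem Homotopy.trans_assoc (B : FreeGroupBasis ι F) (h : Homotopy f f') (h' : Homotopy f' f'')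
    (h'' : Homotopy f'' f''') :
    (h.trans B h').trans B h'' = h.trans B (h'.trans B h'') := by
  have hv := h.isConcatenation B h'
  have hw := (h.trans B h').isConcatenation B h''
  have hv' := h'.isConcatenation B h''
  have hw' : A.IsConcatenation f.φ h.s (h'.trans B h'').s (h.trans B (h'.trans B h'')).s
      (A.omega B f.φ h.s (h'.trans B h'').s) := h.isConcatenation B (h'.trans B h'')
  have hρ : ((h.trans B h').trans B h'').s = (h.trans B (h'.trans B h'')).s :=
    hw.derivation.ext_basis B hw'.derivation fun b => by
      simp only [Homotopy.trans, concat_basis, mul_assoc]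
  rw [← hρ] at hw'
  ext a
  · rw [hρ]
  · have key := IsConcatenation.whisker_assoc B h.phi_eq h'.phi_eq
      h''.isQuadraticDerivation.derivation hv hw hv' hw' (omega_basis B) (omega_basis B)
      (omega_basis B) (omega_basis B) (A'.bd a)
    -- Interchange moves `h.t a` past the filling of the second and third homotopies.
    have hx := A.whisker_mul_eq (hv'.delta_eq (A'.bd a)) (h.t a)
    rw [whisker_mul] at hx
    change _ * A.whisker _ (_ * _ * _) * _ = _ * _ * (_ * _ * _)
    rw [map_mul, map_mul, ← mul_assoc, ← mul_assoc, key, mul_assoc _ (A.omega _ _ _ _ _), ← hx]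
    simp only [Homotopy.trans, mul_assoc]

theorem Homotopy.exists_inverse (B : FreeGroupBasis ι F) (h : Homotopy f f') :
    ∃ k : Homotopy f' f, h.trans B k = Homotopy.refl f ∧ (∀ b, k.s (B b) = (h.s (B b))⁻¹) ∧
      ∀ a, k.t a = (A.omega B f.φ h.s k.s (A'.bd a))⁻¹ * A.sec (h.s (A'.bd a)) (h.t a)⁻¹ := by
  obtain ⟨s', hs', hb⟩ := A.exists_isDerivation B f'.φ fun b => (h.s (B b))⁻¹
  have hw := isConcatenation_concat B h.isQuadraticDerivation.derivation h.phi_eq hs'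
  -- On the basis `s'` is inverse to `h.s`, so the concatenated derivation is trivial there, hence
  -- everywhere.
  have hσ : A.concat B f.φ h.s s' = 1 := hw.derivation.ext_basis B isDerivation_one fun b => by
    simp [concat_basis, hb]
  rw [hσ] at hw
  have hδ : ∀ g, A.δ (A.omega B f.φ h.s s' g) = h.s g * s' g := fun g => by
    rw [hw.delta_eq, Pi.one_apply, one_mul]
  let t' : E' → L := fun a =>
    (A.omega B f.φ h.s s' (A'.bd a))⁻¹ * A.sec (h.s (A'.bd a)) (h.t a)⁻¹
  have ht : concatArrow A' A s' (A.omega B f.φ h.s s') h.t t' = 1 := by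
    funext a
    -- Conjugation by `ω` is the action of `δ ω = s * s'`, so `ω` times the whiskered `t` equals `(s
    -- ▹' t) * ω`, which `t'` inverts.
    have h1 := A.sec_delta (A.omega B f.φ h.s s' (A'.bd a)) (A.whisker (s' (A'.bd a)) (h.t a))
    rw [hδ, whisker, ← MulAut.mul_apply, ← map_mul, mul_inv_cancel_right] at h1
    simp only [concatArrow, t']
    rw [← mul_assoc, whisker, ← h1, map_inv, mul_inv_cancel, Pi.one_apply]
  have hq : IsQuadraticDerivation f' s' t' :=
    (isQuadraticDerivation_concatArrow_iff h.phi_eq h.psi_eq h.isQuadraticDerivation hs' hw).1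
      (ht ▸ isQuadraticDerivation_one f)
  let k : Homotopy f' f :=
    { s := s'
      t := t'
      isQuadraticDerivation := hq
      mu_eq := fun l => by
        have h1 := congrFun ht (A'.δ l)
        rw [concatArrow, A'.bd_delta, hs'.map_one, whisker_one, Pi.one_apply,
          show A.omega B f.φ h.s s' 1 = 1 by simp [omega], one_mul] at h1
        rw [h.mu_eq, mul_assoc, h1, mul_one]
      psi_eq := fun a => by
        have h1 := congrArg A.δ (congrFun ht a)
        rw [concatArrow, map_mul, map_mul, delta_whisker, hδ, Pi.one_apply, map_one] at h1
        rw [h.psi_eq]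
        calc f.ψ a = f.ψ a * 1 := (mul_one _).symm
          _ = _ := by
            rw [← h1]
            group
      phi_eq := fun g => by
        have h1 := congrArg A.bd (hδ g)
        rw [A.bd_delta, map_mul] at h1
        rw [h.phi_eq, mul_assoc, ← h1, mul_one] }
  exact ⟨k, Homotopy.trans_eq B hw (omega_basis B) (congrFun ht), hb, fun _ => rfl⟩

/-- The reverse of a homotopy. -/
noncomputable def Homotopy.symm (B : FreeGroupBasis ι F) (h : Homotopy f f') : Homotopy f' f :=
  (h.exists_inverse B).choose

theorem Homotopy.trans_symm (B : FreeGroupBasis ι F) (h : Homotopy f f') :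
    h.trans B (h.symm B) = Homotopy.refl f :=
  (h.exists_inverse B).choose_spec.1

/-- As in a group, right inverses for all elements are two-sided: `h` is the right inverse of its
own right inverse. -/
theorem Homotopy.symm_trans (B : FreeGroupBasis ι F) (h : Homotopy f f') :
    (h.symm B).trans B h = Homotopy.refl f' := by
  have h1 : h = (h.symm B).symm B := by
    calc h = h.trans B ((h.symm B).trans B ((h.symm B).symm B)) := by rw [trans_symm, trans_refl]
      _ = _ := by rw [← trans_assoc, trans_symm, refl_trans]
  nth_rw 2 [h1]
  rw [trans_symm]

/-- The groupoid of 2-crossed module maps and homotopies. -/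
noncomputable abbrev homotopyGroupoid (A' : TwoCrossedModule L' E' F)
    (A : TwoCrossedModule L E G) (B : FreeGroupBasis ι F) :
    CategoryTheory.Groupoid (Hom A' A) where
  Hom f f' := Homotopy f f'
  id f := Homotopy.refl f
  comp h h' := h.trans B h'
  id_comp h := h.refl_trans B
  comp_id h := h.trans_refl B
  assoc h h' h'' := h.trans_assoc B h' h''
  inv h := h.symm B
  inv_comp h := h.symm_trans B
  comp_inv h := h.trans_symm B

end Homotopy
end TwoCrossedModule

theorem mainTheorem2
    {ι : Type*} {L' : Type u₁} {E' : Type u₂} {F : Type u₃} {L : Type u₄} {E : Type u₅} {G : Type u₆}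
    [Group L'] [Group E'] [Group F] [Group L] [Group E] [Group G]
    (A' : TwoCrossedModule L' E' F) (A : TwoCrossedModule L E G) (B : FreeGroupBasis ι F) :
    ∃ (𝒢 : CategoryTheory.Groupoid.{max u₂ u₃ u₄ u₅} (TwoCrossedModule.Hom A' A))
      (hom : ∀ f f' : TwoCrossedModule.Hom A' A,
        𝒢.Hom f f' ≃ TwoCrossedModule.Homotopy f f'),
      -- concatenation
      (∀ (f f' f'' : TwoCrossedModule.Hom A' A) (h : 𝒢.Hom f f') (h' : 𝒢.Hom f' f''),
        A.IsTheDerivation B f.φ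
          (fun b => (hom f f' h).s (B b) * (hom f' f'' h').s (B b))
          (hom f f'' (𝒢.comp h h')).s ∧
        (∀ g, (hom f f'' (𝒢.comp h h')).s g =
          (hom f f' h).s g * (hom f' f'' h').s g *
            (A.δ (A.omega B f.φ (hom f f' h).s (hom f' f'' h').s g))⁻¹) ∧
        (∀ e, (hom f f'' (𝒢.comp h h')).t e =
          A.omega B f.φ (hom f f' h).s (hom f' f'' h').s (A'.bd e) *
            A.sec ((hom f' f'' h').s (A'.bd e))⁻¹ ((hom f f' h).t e) *
            (hom f' f'' h').t e)) ∧
      -- units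
      (∀ f : TwoCrossedModule.Hom A' A,
        (∀ g, (hom f f (𝒢.id f)).s g = 1) ∧ ∀ e, (hom f f (𝒢.id f)).t e = 1) ∧
      -- inverses
      (∀ (f f' : TwoCrossedModule.Hom A' A) (h : 𝒢.Hom f f'),
        A.IsTheDerivation B f'.φ (fun b => ((hom f f' h).s (B b))⁻¹)
          (hom f' f (𝒢.inv h)).s ∧
        ∀ e, (hom f' f (𝒢.inv h)).t e =
          (A.omega B f.φ (hom f f' h).s (hom f' f (𝒢.inv h)).s (A'.bd e))⁻¹ *
            A.sec ((hom f f' h).s (A'.bd e)) ((hom f f' h).t e)⁻¹) := by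
  refine ⟨TwoCrossedModule.homotopyGroupoid A' A B, fun _ _ => Equiv.refl _, ?_, ?_, ?_⟩
  · intro f f' f'' h h'
    have hw := TwoCrossedModule.Homotopy.isConcatenation B h h'
    exact ⟨hw.derivation.isTheDerivation B (TwoCrossedModule.concat_basis B),
      fun g => (mul_inv_eq_of_eq_mul (hw.delta_eq g)).symm, fun _ => rfl⟩
  · exact fun f => ⟨fun _ => rfl, fun _ => rfl⟩
  · intro f f' h
    have hk := (TwoCrossedModule.Homotopy.exists_inverse B h).choose_spec
    exact ⟨(TwoCrossedModule.Homotopy.isQuadraticDerivation _).derivation.isTheDerivation B hk.2.1,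
      hk.2.2⟩
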